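/- Let $p$ be a prime with $p\equiv 2\pmod 3$ (the case $p=2$ is included), let $s,m\ge 1$, $q=p^s$, $r=q^m$, let $\alpha$ be a generator of the multiplicative group $\mathbb F_r^*$, and let $h$ be a positive divisor of $q-1$. Put $e=3$ and assume that $e\mid\gcd(q-1,hm)$ and that \[N:=\gcd\Bigl(\frac{r-1}{q-1},\frac{e(q-1)}{h}\Bigr)=3 .\] Let $g=\alpha^{(q-1)/h}$, $\beta=\alpha^{(r-1)/3}$, $n=\frac{h(r-1)}{q-1}$, let $\mathrm{Tr}$ be the trace from $\mathbb F_r$ to $\mathbb F_q$, and let \[\mathcal C=\{c_{(a,b)}: a,b\in\mathbb F_r\},\qquad c_{(a,b)}=\bigl(\mathrm{Tr}(ag^i+b(\beta g)^i)\bigr)_{i=0}^{n-1}\in\mathbb F_q^n .\] Define the modified weight $\lambda(c)$ of a codeword $c$ by $\lambda(c)=\frac{h(r-1)}{q}-w(c)$, where $w(c)$ is its Hamming weight. Write $S=(-1)^{ms/2}\sqrt r$ (here $s$ is even, because $3\mid q-1$). Then the map $(a,b)\mapsto c_{(a,b)}$ is injective, and the following holds, where for each real $w$ the number of codewords $c\in\mathcal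 C$ with $\lambda(c)=w$ is the sum of the frequencies of the rows of weight $w$ in the table named (so it is $0$ if there is no such row, and the frequencies of rows whose weights coincide are added). (1) If $3\mid\frac{q-1}{h}$, the modified weight distribution of $\mathcal C$ is given by Table 1: \[\begin{array}{|c|c|}\hline \text{weight }\lambda & \text{frequency}\\\hline -\frac hq\{2S+1\} & \frac{r-1}{27}\{r-8-2S\}\\ \frac hq\{S-1\} & \frac{2(r-1)}{27}\{4r-14+S\}\\ -\frac hq\{S+1\} & \frac{2(r-1)}{9}\{r-2+S\}\\ -\frac hq & \frac{2(r-1)}{9}\{2r-1-S\}\\ \frac h{3q}\{r-4S-3\} & r-1\\ \frac h{3q}\{r+2S-3\} & 2(r-1)\\ \frac{h(r-1)}q & 1\\\hline\end{array}\] (2) If $3\nmid\frac{q-1}{h}$, the modified weight distribution of $\mathcal C$ is given by Table 2: \[\begin{array}{|c|c|}\hline \text{weight }\lambda & \text{frequency}\\\hline -\frac hq\{2S+1\} & \frac{r-1}{27}\{r+1-2S\}\\ \frac hq\{S-1\} & \frac{2(r-1)}{27}\{4r-5+S\}\\ -\frac hq\{S+1\} & \frac{2(r-1)}{9}\{r-2+S\}\\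 -\frac hq & \frac{r-1}{9}\{4r-11-2S\}\\ \frac h{3q}\{r+2S-3\} & r-1\\ \frac h{3q}\{r-S-3\} & 2(r-1)\\ \frac{h(r-1)}q & 1\\\hline\end{array}\] (In both tables the last row belongs to the zero codeword; the other six rows give the nonzero Hamming weights, so there are at most six of them.) -/

import Mathlib

namespace CyclicCodeTwoZeros

/-- The length `n = h (r - 1) / (q - 1)`. The division is exact when `r` is a power of `q`. -/
def codeLength (q r h : ℕ) : ℕ := h * (r - 1) / (q - 1)

/-- The number `N = gcd ((r - 1) / (q - 1), e (q - 1) / h)`. Both divisions are exact when `r` is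
a power of `q` and `h` divides `q - 1`. -/
def paramN (q r h e : ℕ) : ℕ := Nat.gcd ((r - 1) / (q - 1)) (e * (q - 1) / h)

/-- The codeword `c(a, b) = (Tr (a g ^ i + b (β g) ^ i))` for `0 ≤ i < n`, where
`g = α ^ ((q - 1) / h)`, `β = α ^ ((r - 1) / e)` and `Tr` is the trace from `K` to `F`. -/
noncomputable def codeword (F : Type*) {K : Type*} [Field F] [Field K] [Algebra F K]
    (q r h e : ℕ) (α : Kˣ) (a b : K) : Fin (codeLength q r h) → F :=
  fun i =>
    let g : K := (α : K) ^ ((q - 1) / h)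
    let β : K := (α : K) ^ ((r - 1) / e)
    Algebra.trace F K (a * g ^ (i : ℕ) + b * (β * g) ^ (i : ℕ))

/-- The cyclic code: the set of all codewords `c(a, b)` with `a, b` in `K`. -/
def cyclicCode (F : Type*) {K : Type*} [Field F] [Field K] [Algebra F K]
    (q r h e : ℕ) (α : Kˣ) : Set (Fin (codeLength q r h) → F) :=
  {c | ∃ a b : K, c = codeword F q r h e α a b}

open Classical in
/-- The modified weight `h (r - 1) / q - w(c)`, where `w(c)` is the Hamming weight. -/
noncomputable def modifiedWeight {F : Type*} [Field F] (q r h : ℕ)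
    (c : Fin (codeLength q r h) → F) : ℝ :=
  (h : ℝ) * ((r : ℝ) - 1) / (q : ℝ) - (hammingNorm c : ℝ)

/-- The modified weight distribution of the set `C` of words is given by the table `T`, a list of
rows (weight, frequency): for every real `w`, the number of words in `C` of modified weight `w` is
the sum of the frequencies of the rows of weight `w` (so it is zero if `w` does not occur in `T`,
and the frequencies are added if several rows happen to have the same weight). -/
def HasModifiedWeightDistribution {F : Type*} [Field F] (q r h : ℕ)
    (C : Set (Fin (codeLength q r h) → F)) (T : List (ℝ × ℝ)) : Prop :=
  ∀ w : ℝ, (({c | c ∈ C ∧ modifiedWeight q r h c = w} : Set _).ncard : ℝ) =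
    (T.map fun row => open Classical in if row.1 = w then row.2 else 0).sum

/-- The table for the case `3 ∣ (q - 1) / h`, where `S` stands for `(-1) ^ (m s / 2) √r`. -/
noncomputable def table1 (q r h S : ℝ) : List (ℝ × ℝ) :=
  [ (-(h / q) * (2 * S + 1),          (r - 1) / 27 * (r - 8 - 2 * S)),
    (h / q * (S - 1),                 2 * (r - 1) / 27 * (4 * r - 14 + S)),
    (-(h / q) * (S + 1),              2 * (r - 1) / 9 * (r - 2 + S)),
    (-(h / q),                        2 * (r - 1) / 9 * (2 * r - 1 - S)),
    (h / (3 * q) * (r - 4 * S - 3),   r - 1),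
    (h / (3 * q) * (r + 2 * S - 3),   2 * (r - 1)),
    (h * (r - 1) / q,                 1) ]

/-- The table for the case `¬ 3 ∣ (q - 1) / h`, where `S` stands for `(-1) ^ (m s / 2) √r`. -/
noncomputable def table2 (q r h S : ℝ) : List (ℝ × ℝ) :=
  [ (-(h / q) * (2 * S + 1),          (r - 1) / 27 * (r + 1 - 2 * S)),
    (h / q * (S - 1),                 2 * (r - 1) / 27 * (4 * r - 5 + S)),
    (-(h / q) * (S + 1),              2 * (r - 1) / 9 * (r - 2 + S)),
    (-(h / q),                        (r - 1) / 9 * (4 * r - 11 - 2 * S)),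
    (h / (3 * q) * (r + 2 * S - 3),   r - 1),
    (h / (3 * q) * (r - S - 3),       2 * (r - 1)),
    (h * (r - 1) / q,                 1) ]

end CyclicCodeTwoZeros

/-!
Let `K` have `r = 3 N + 1` elements, let `C` be the group of nonzero cubes of `K` and let
`η(y) = ∑ x ∈ C, ψ (x y)` be the Gaussian period attached to an additive character `ψ` that factors
through the traces to `F` and to the prime field.

*Weights.* Splitting the positions `i` of a codeword by their residue `t` modulo `3`, and using that
the elements `l g ^ (3 j)` with `l ∈ Fˣ` run through `C` with multiplicity `h` (this is what
`gcd = 3` provides, `sum_sum_range_pow`), the modified weight of `c(a, b)` becomes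
`(h / q) ∑ η (g ^ t (a + b β ^ t))` over `t = 0, 1, 2` (`modifiedWeight_codeword`).

*Periods.* `η` depends only on the cubic class of its argument. Since `p ≡ 2` modulo `3`, Frobenius
interchanges the two classes of noncubes, so `η` takes only two values on nonzero arguments. The
sums of `η` and of `η ^ 2` show that `3 η + 1` is a square root of `r` on noncubes; its sign follows
from `η` being a rational algebraic integer, hence an integer (`period_of_noncube`). Neither Gauss sums
nor the theorems of Stickelberger and Davenport-Hasse are needed.

*Frequencies.* The elements `a + b β ^ t`, multiplied by `β ^ t`, form an arbitrary triple of sum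
zero, and `β` is a cube because `9` divides `r - 1`. So the task is to count triples of sum zero by the
number of zero entries and of entries in three given cosets of `C`. Inclusion and exclusion
(`sum_zeroSum_patterns`) reduces this to the case in which all entries lie in the cosets, which is a
third moment of the periods: `card_zeroSumTriples_of_cube` if `g` is a cube (`table1`) and
`card_zeroSumTriples_of_noncube` if not (`table2`). Injectivity holds because only the zero triple
attains the modified weight of the zero word.
-/

namespace CyclicCodeTwoZeros

open Finset

/-! ### Gaussian periods of order three -/

section

variable {K : Type*} [Field K] [Fintype K]

section

variable {N : ℕ} (hN : 3 * N + 1 = Fintype.card K)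
include hN

lemma pow_pow_three {x : K} (hx : x ≠ 0) : (x ^ N) ^ 3 = 1 := by
  rw [← pow_mul, show N * 3 = Fintype.card K - 1 by omega]
  exact FiniteField.pow_card_sub_one_eq_one x hx

lemma pos_of_card : 0 < N := by
  have := Fintype.one_lt_card (α := K)
  omega

lemma zero_pow_ne_one : (0 : K) ^ N ≠ 1 := by
  rw [zero_pow (pos_of_card hN).ne']; exact zero_ne_one

lemma neg_one_pow_eq_one : (-1 : K) ^ N = 1 := by
  have h2 : ((-1 : K) ^ N) ^ 2 = 1 := by rw [← pow_mul, mul_comm, pow_mul]; simp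
  have h3 := pow_pow_three hN (neg_ne_zero.2 (one_ne_zero (α := K)))
  rw [pow_succ, h2, one_mul] at h3
  exact h3

lemma neg_pow_eq (x : K) : (-x) ^ N = x ^ N := by
  rw [neg_eq_neg_one_mul, mul_pow, neg_one_pow_eq_one hN, one_mul]

lemma one_add_pow_add_sq {a : K} (ha0 : a ≠ 0) (ha : a ^ N ≠ 1) :
    1 + a ^ N + (a ^ N) ^ 2 = 0 := by
  have h3 := pow_pow_three hN ha0
  have : (a ^ N - 1) * (1 + a ^ N + (a ^ N) ^ 2) = 0 := by linear_combination h3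
  exact (mul_eq_zero.1 this).resolve_left (sub_ne_zero.2 ha)

/-- A noncube `a` represents a generator of the group of cubic classes, so exactly one of `y`, `a * y`
and `a ^ 2 * y` is a cube. -/
lemma trichotomy {a : K} (ha0 : a ≠ 0) (ha : a ^ N ≠ 1) {y : K} (hy : y ≠ 0) :
    (y ^ N = 1 ∧ (a * y) ^ N ≠ 1 ∧ (a ^ 2 * y) ^ N ≠ 1) ∨
    (y ^ N ≠ 1 ∧ (a * y) ^ N = 1 ∧ (a ^ 2 * y) ^ N ≠ 1) ∨
    (y ^ N ≠ 1 ∧ (a * y) ^ N ≠ 1 ∧ (a ^ 2 * y) ^ N = 1) := by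
  have hω3 := pow_pow_three hN ha0
  have hω := one_add_pow_add_sq hN ha0 ha
  have hu3 := pow_pow_three hN hy
  have e2 : (a ^ 2 * y) ^ N = (a ^ N) ^ 2 * y ^ N := by
    rw [mul_pow, ← pow_mul, ← pow_mul, mul_comm 2]
  rw [e2, mul_pow]
  generalize a ^ N = ω at *
  generalize y ^ N = u at *
  have hω0 : ω ≠ 0 := by rintro rfl; simp at hω
  have hω2 : ω ^ 2 ≠ 1 := fun h => ha (by linear_combination hω3 - ω * h)
  have hfac : (u - 1) * ((u - ω ^ 2) * (u - ω)) = 0 := by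
    linear_combination hu3 - (u - 1) * u * hω + (u - 1) * hω3
  rcases mul_eq_zero.1 hfac with h | h
  · have hu : u = 1 := by linear_combination h
    subst hu
    exact Or.inl ⟨rfl, by simpa using ha, by simpa using hω2⟩
  rcases mul_eq_zero.1 h with h | h
  · have hu : u = ω ^ 2 := by linear_combination h
    subst hu
    refine Or.inr (Or.inl ⟨hω2, by linear_combination hω3, fun h => ha ?_⟩)
    linear_combination h - ω * hω3
  · have hu : u = ω := by linear_combination h
    subst hu
    exact Or.inr (Or.inr ⟨ha, fun h => hω2 (by linear_combination h), by linear_combination hω3⟩)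

end

variable [DecidableEq K]

variable (K) in
/-- For `3 * N + 1 = #K` this is the set of nonzero cubes of `K`, given by Euler's criterion. -/
def cubeClass (N : ℕ) : Finset K := {x | x ^ N = 1}

lemma mem_cubeClass {N : ℕ} {x : K} : x ∈ cubeClass K N ↔ x ^ N = 1 := by
  simp [cubeClass]

/-- The Gaussian period of order three `∑ ψ (x * y)`, the sum over the nonzero cubes `x`, as a
function of `y`. -/
noncomputable def period (ψ : AddChar K ℂ) (N : ℕ) (y : K) : ℂ :=
  ∑ x ∈ cubeClass K N, ψ (x * y)

section

variable {N : ℕ} (hN : 3 * N + 1 = Fintype.card K)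
include hN

/-- The nonzero elements of `K` are the union of the three cosets of the group of cubes. -/
lemma sum_eq_zero_add_sum_cubeClass {a : K} (ha0 : a ≠ 0) (ha : a ^ N ≠ 1)
    {M : Type*} [AddCommMonoid M] (G : K → M) :
    ∑ y, G y = G 0 + ∑ x ∈ cubeClass K N, (G x + G (a * x) + G (a ^ 2 * x)) := by
  have key : ∀ b : K, b ≠ 0 →
      ∑ x ∈ cubeClass K N, G (b * x) = ∑ y, if (b⁻¹ * y) ^ N = 1 then G y else 0 := by
    intro b hb
    rw [cubeClass, sum_filter]
    exact Fintype.sum_equiv (Equiv.mulLeft₀ b hb) _ _ (fun x => by simp [hb])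
  have h1 := key 1 one_ne_zero
  simp only [one_mul, inv_one] at h1
  rw [sum_add_distrib, sum_add_distrib, h1, key a ha0, key (a ^ 2) (pow_ne_zero 2 ha0),
    ← sum_add_distrib, ← sum_add_distrib]
  have h0 : G 0 = ∑ y : K, if y = 0 then G y else 0 := by simp
  rw [h0, ← sum_add_distrib]
  refine sum_congr rfl fun y _ => ?_
  by_cases hy : y = 0
  · subst hy
    simp [zero_pow_ne_one hN]
  have hai : a⁻¹ ^ N ≠ 1 := by rwa [inv_pow, ne_eq, inv_eq_one]
  have := trichotomy hN (inv_ne_zero ha0) hai hy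
  rw [inv_pow] at this
  rcases this with ⟨h1, h2, h3⟩ | ⟨h1, h2, h3⟩ | ⟨h1, h2, h3⟩ <;> simp [h1, h2, h3, hy]

lemma card_cubeClass {a : K} (ha0 : a ≠ 0) (ha : a ^ N ≠ 1) : #(cubeClass K N) = N := by
  have := sum_eq_zero_add_sum_cubeClass hN ha0 ha (fun _ => 1)
  simp only [sum_const, card_univ, smul_eq_mul, mul_one] at this
  omega

end

section

variable {N : ℕ} (ψ : AddChar K ℂ)

/-- Gaussian periods depend only on the cubic class of the argument. -/
lemma period_mul {c : K} (hc0 : c ≠ 0) (hc : c ^ N = 1) (y : K) :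
    period ψ N (c * y) = period ψ N y := by
  rw [period, period, cubeClass, sum_filter, sum_filter]
  refine Fintype.sum_equiv (Equiv.mulLeft₀ c hc0) _ _ fun x => ?_
  simp only [Equiv.mulLeft₀_apply, mul_pow, hc, one_mul]
  congr 2
  ring

lemma period_zero : period ψ N 0 = #(cubeClass K N) := by
  simp [period]

lemma isIntegral_period (y : K) : IsIntegral ℤ (period ψ N y) := by
  refine IsIntegral.sum _ fun x _ => ?_
  refine IsIntegral.of_pow (n := Fintype.card K) Fintype.card_pos ?_
  rw [← AddChar.map_nsmul_eq_pow, card_nsmul_eq_zero, AddChar.map_zero_eq_one]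
  exact isIntegral_one

lemma period_frobenius {p : ℕ} [Fact p.Prime] [CharP K p] (hψp : ∀ x, ψ (x ^ p) = ψ x) (y : K) :
    period ψ N (y ^ p) = period ψ N y := by
  rw [period, period, cubeClass, sum_filter, sum_filter]
  refine (Fintype.sum_equiv (frobeniusEquiv K p).toEquiv _ _ fun x => ?_).symm
  have h : (x ^ p) ^ N = 1 ↔ x ^ N = 1 := by
    rw [← pow_mul, mul_comm, pow_mul]
    constructor
    · intro h
      apply (frobeniusEquiv K p).injective
      simpa [frobeniusEquiv_apply, frobenius_def] using h
    · intro h; rw [h, one_pow]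
  simp [frobeniusEquiv_apply, frobenius_def, h, ← mul_pow, hψp]

variable {ψ} (hψ : ψ ≠ 1)
include hψ

lemma sum_addChar_mul (b : K) : ∑ x, ψ (x * b) = if b = 0 then (Fintype.card K : ℂ) else 0 := by
  simpa using AddChar.sum_mulShift b (AddChar.IsPrimitive.of_ne_one hψ)

lemma sum_periods (hN : 3 * N + 1 = Fintype.card K) {a : K} (ha0 : a ≠ 0) (ha : a ^ N ≠ 1) :
    period ψ N 1 + period ψ N a + period ψ N (a ^ 2) = -1 := by
  have h := sum_addChar_mul hψ 1
  rw [sum_eq_zero_add_sum_cubeClass hN ha0 ha] at h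
  simp only [mul_one, AddChar.map_zero_eq_one, one_ne_zero, if_false] at h
  simp only [period, ← sum_add_distrib, mul_one]
  simp only [mul_comm a, mul_comm (a ^ 2)] at h
  linear_combination h

lemma sum_period_sq (hN : 3 * N + 1 = Fintype.card K) :
    ∑ y, period ψ N y ^ 2 = Fintype.card K * #(cubeClass K N) := by
  have h : ∀ y, period ψ N y ^ 2 =
      ∑ x ∈ cubeClass K N, ∑ x' ∈ cubeClass K N, ψ (y * (x + x')) := by
    intro y
    rw [sq, period, sum_mul_sum]
    refine sum_congr rfl fun x _ => sum_congr rfl fun x' _ => ?_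
    rw [← AddChar.map_add_eq_mul]; congr 1; ring
  simp_rw [h]
  rw [sum_comm]
  simp_rw [sum_comm (s := univ), sum_addChar_mul hψ]
  have : ∀ x ∈ cubeClass K N,
      (∑ x' ∈ cubeClass K N, if x + x' = 0 then (Fintype.card K : ℂ) else 0) = Fintype.card K := by
    intro x hx
    rw [sum_eq_single_of_mem (-x)]
    · simp
    · rw [mem_cubeClass, neg_pow_eq hN]; exact mem_cubeClass.1 hx
    · intro b _ hb
      rw [if_neg]; contrapose! hb; exact eq_neg_of_add_eq_zero_right hb
  rw [sum_congr rfl this, sum_const, nsmul_eq_mul, mul_comm]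

/-- The periods of a noncube and of its square agree when the characteristic is `2` modulo `3`,
since Frobenius interchanges their classes. The first two moments of the periods then give a
quadratic equation. -/
lemma sq_period_of_noncube (hN : 3 * N + 1 = Fintype.card K) {p : ℕ} [Fact p.Prime] [CharP K p]
    (hp : p % 3 = 2) (hψp : ∀ x, ψ (x ^ p) = ψ x) {a : K} (ha0 : a ≠ 0) (ha : a ^ N ≠ 1) :
    period ψ N 1 = -1 - 2 * period ψ N a ∧ period ψ N (a ^ 2) = period ψ N a ∧
      (3 * period ψ N a + 1) ^ 2 = Fintype.card K := by
  have h21 : period ψ N (a ^ 2) = period ψ N a := by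
    rw [← period_frobenius ψ hψp a]
    have e : a ^ p = (a ^ (p / 3)) ^ 3 * a ^ 2 := by
      rw [← pow_mul, ← pow_add]; congr 1; omega
    rw [e, period_mul ψ (pow_ne_zero _ (pow_ne_zero _ ha0))]
    rw [← pow_mul, mul_comm, pow_mul]
    exact pow_pow_three hN (pow_ne_zero _ ha0)
  have h1 := sum_periods hψ hN ha0 ha
  have h2 := sum_period_sq (N := N) hψ hN
  have hc : (Fintype.card K : ℂ) = 3 * N + 1 := by rw [← hN]; push_cast; ring
  have hN0 : (N : ℂ) ≠ 0 := Nat.cast_ne_zero.2 (pos_of_card hN).ne'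
  rw [sum_eq_zero_add_sum_cubeClass hN ha0 ha, sum_congr rfl (g := fun _ =>
    period ψ N 1 ^ 2 + period ψ N a ^ 2 + period ψ N (a ^ 2) ^ 2), period_zero, sum_const,
    card_cubeClass hN ha0 ha, nsmul_eq_mul] at h2
  · have h0 : period ψ N 1 = -1 - 2 * period ψ N a := by rw [h21] at h1; linear_combination h1
    refine ⟨h0, h21, mul_left_cancel₀ hN0 ?_⟩
    rw [h21, h0, hc] at h2
    rw [hc]
    linear_combination (3 / 2 : ℂ) * h2
  · intro x hx
    have hxN := mem_cubeClass.1 hx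
    have hx0 : x ≠ 0 := by rintro rfl; exact zero_pow_ne_one hN hxN
    have e1 := period_mul ψ hx0 hxN 1
    rw [mul_one] at e1
    rw [mul_comm a, mul_comm (a ^ 2), period_mul ψ hx0 hxN, period_mul ψ hx0 hxN, e1]

/-- The semiprimitive case of the evaluation of cubic Gaussian periods: for `#K = p ^ (2 * k)`, the
sign of the square root is found from the fact that a rational period is an integer. -/
lemma period_of_noncube (hN : 3 * N + 1 = Fintype.card K) {p k : ℕ} [Fact p.Prime] [CharP K p]
    (hp : p % 3 = 2) (hk : Fintype.card K = p ^ (2 * k)) (hψp : ∀ x, ψ (x ^ p) = ψ x)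
    {a : K} (ha0 : a ≠ 0) (ha : a ^ N ≠ 1) :
    3 * period ψ N a + 1 = (-p : ℂ) ^ k := by
  obtain ⟨-, -, h⟩ := sq_period_of_noncube hψ hN hp hψp ha0 ha
  have hS : (Fintype.card K : ℂ) = ((-p : ℂ) ^ k) ^ 2 := by
    rw [hk, ← pow_mul, mul_comm k, pow_mul (-(p : ℂ)), neg_sq, pow_mul]; push_cast; ring
  rw [hS] at h
  rcases sq_eq_sq_iff_eq_or_eq_neg.1 h with h | h
  · exact h
  exfalso
  have hr : period ψ N a = algebraMap ℚ ℂ ((-(-p : ℚ) ^ k - 1) / 3) := by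
    have : period ψ N a = (-(-p : ℂ) ^ k - 1) / 3 := by linear_combination (1 / 3 : ℂ) * h
    rw [this]; simp
  have hint := isIntegral_period (N := N) ψ a
  rw [hr, isIntegral_algebraMap_iff (algebraMap ℚ ℂ).injective,
    IsIntegrallyClosed.isIntegral_iff] at hint
  obtain ⟨z, hz⟩ := hint
  have hz' : (3 * z + 1 + (-(p : ℤ)) ^ k : ℤ) = 0 := by
    have : (3 * z + 1 + (-(p : ℚ)) ^ k : ℚ) = 0 := by
      simp only [algebraMap_int_eq, eq_intCast] at hz
      rw [hz]; ring
    exact_mod_cast this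
  have hmod : (-(p : ℤ)) ^ k ≡ 1 [ZMOD 3] := by
    have : -(p : ℤ) ≡ 1 [ZMOD 3] := by unfold Int.ModEq; omega
    simpa using this.pow k
  unfold Int.ModEq at hmod
  omega

end

end

/-! ### Zero-sum triples with prescribed cubic classes -/

section

section

variable {K : Type*} [Fintype K]

lemma sum_fst_mul_snd (f g : K → ℝ) :
    ∑ v : K × K, f v.1 * g v.2 = (∑ x, f x) * ∑ x, g x := by
  rw [Fintype.sum_prod_type, sum_mul_sum]

variable [AddCommGroup K]

lemma sum_snd_mul_neg_add (f g : K → ℝ) :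
    ∑ v : K × K, f v.2 * g (-(v.1 + v.2)) = (∑ x, f x) * ∑ x, g x := by
  rw [Fintype.sum_prod_type_right, sum_mul]
  refine sum_congr rfl fun y _ => ?_
  rw [mul_sum]
  exact Fintype.sum_equiv ((Equiv.addRight y).trans (Equiv.neg K)) _ _ fun x => by simp

lemma sum_fst_mul_neg_add (f g : K → ℝ) :
    ∑ v : K × K, f v.1 * g (-(v.1 + v.2)) = (∑ x, f x) * ∑ x, g x := by
  rw [Fintype.sum_prod_type, sum_mul]
  refine sum_congr rfl fun y _ => ?_
  rw [mul_sum]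
  exact Fintype.sum_equiv ((Equiv.addLeft y).trans (Equiv.neg K)) _ _ fun x => by simp

variable [DecidableEq K]

/-- The pairs `(x, y)` for which the triple `(x, y, -(x + y))` of sum zero lies in `A × B × C`. -/
def zeroSumTriples (A B C : Finset K) : Finset (K × K) :=
  {v | v.1 ∈ A ∧ v.2 ∈ B ∧ -(v.1 + v.2) ∈ C}

/-- Triples `(x, y, w)` of sum zero, sorted by the number of zero entries and the number of entries
that lie in prescribed sets `A`, `B`, `C` avoiding `0`. Apart from the cardinalities, only the
numbers `P` of pairs `x, -x` in two of the sets and the number of zero-sum triples in `A × B × C`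
enter. The coefficients come from inclusion and exclusion. -/
lemma sum_zeroSum_patterns {A B C : Finset K} {N P : ℕ} (hA : #A = N) (hB : #B = N) (hC : #C = N)
    (hA0 : 0 ∉ A) (hB0 : 0 ∉ B) (hC0 : 0 ∉ C)
    (hAB : #{x ∈ A | -x ∈ B} = P) (hAC : #{x ∈ A | -x ∈ C} = P) (hBC : #{x ∈ B | -x ∈ C} = P)
    {r T : ℝ} (hr : r = Fintype.card K) (hT : T = #(zeroSumTriples A B C)) (Φ : ℕ → ℕ → ℝ) :
    ∑ v : K × K,
      Φ ((if v.1 = 0 then 1 else 0) + (if v.2 = 0 then 1 else 0) +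
          (if -(v.1 + v.2) = 0 then 1 else 0))
        ((if v.1 ∈ A then 1 else 0) + (if v.2 ∈ B then 1 else 0) +
          (if -(v.1 + v.2) ∈ C then 1 else 0)) =
      Φ 3 0 + 3 * P * Φ 1 2 + (6 * N - 6 * P) * Φ 1 1 + (3 * r - 3 - 6 * N + 3 * P) * Φ 1 0 +
        T * Φ 0 3 + (3 * N ^ 2 - 3 * P - 3 * T) * Φ 0 2 +
        (3 * N * r - 6 * N - 6 * N ^ 2 + 6 * P + 3 * T) * Φ 0 1 +
        (r ^ 2 - 3 * r + 2 - 3 * N * r + 6 * N + 3 * N ^ 2 - 3 * P - T) * Φ 0 0 := by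
  let z : K → ℝ := fun x => if x = 0 then 1 else 0
  let a : K → ℝ := fun x => if x ∈ A then 1 else 0
  let b : K → ℝ := fun x => if x ∈ B then 1 else 0
  let c : K → ℝ := fun x => if x ∈ C then 1 else 0
  have sz : ∑ x, z x = 1 := by simp [z]
  have sa : ∑ x, a x = N := by simp [a, hA]
  have sb : ∑ x, b x = N := by simp [b, hB]
  have sc : ∑ x, c x = N := by simp [c, hC]
  have s1 : ∑ x : K, (1 : ℝ) = r := by simp [hr]
  -- the monomials in the indicators, summed over all triples
  have m0 : ∑ v : K × K, (1 : ℝ) = r ^ 2 := by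
    simp [hr, Fintype.card_prod, sq]
  have mz : ∑ v : K × K, (z v.1 + z v.2 + z (-(v.1 + v.2))) = 3 * r := by
    have h1 := sum_fst_mul_snd z 1
    have h2 := sum_fst_mul_snd 1 z
    have h3 := sum_fst_mul_neg_add 1 z
    simp only [Pi.one_apply, mul_one, one_mul, sz, s1] at h1 h2 h3
    rw [sum_add_distrib, sum_add_distrib, h1, h2, h3]; ring
  have ma : ∑ v : K × K, (a v.1 + b v.2 + c (-(v.1 + v.2))) = 3 * N * r := by
    have h1 := sum_fst_mul_snd a 1
    have h2 := sum_fst_mul_snd 1 b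
    have h3 := sum_fst_mul_neg_add 1 c
    simp only [Pi.one_apply, mul_one, one_mul, sa, sb, sc, s1] at h1 h2 h3
    rw [sum_add_distrib, sum_add_distrib, h1, h2, h3]; ring
  have maa : ∑ v : K × K, (a v.1 * b v.2 + a v.1 * c (-(v.1 + v.2)) + b v.2 * c (-(v.1 + v.2)))
      = 3 * N ^ 2 := by
    rw [sum_add_distrib, sum_add_distrib, sum_fst_mul_snd, sum_fst_mul_neg_add,
      sum_snd_mul_neg_add, sa, sb, sc]; ring
  have mza : ∑ v : K × K, (z v.1 * b v.2 + z v.1 * c (-(v.1 + v.2)) + a v.1 * z v.2 +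
      z v.2 * c (-(v.1 + v.2)) + a v.1 * z (-(v.1 + v.2)) + b v.2 * z (-(v.1 + v.2))) = 6 * N := by
    simp only [sum_add_distrib, sum_fst_mul_snd, sum_fst_mul_neg_add,
      sum_snd_mul_neg_add, sa, sb, sc, sz]; ring
  have mzz : ∑ v : K × K, z v.1 * z v.2 = 1 := by
    rw [sum_fst_mul_snd, sz, one_mul]
  have mzaa : ∑ v : K × K, (z v.1 * b v.2 * c (-(v.1 + v.2)) + a v.1 * z v.2 * c (-(v.1 + v.2)) +
      a v.1 * b v.2 * z (-(v.1 + v.2))) = 3 * P := by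
    have hpair : ∀ A B : Finset K, ∑ x, (if x ∈ A then (1 : ℝ) else 0) * (if -x ∈ B then 1 else 0) =
        #{x ∈ A | -x ∈ B} := by
      intro A B
      simp_rw [ite_mul, one_mul, zero_mul]
      rw [← sum_filter, filter_mem_eq_inter, univ_inter, card_filter]
      push_cast
      rfl
    have e1 : ∑ v : K × K, z v.1 * b v.2 * c (-(v.1 + v.2)) = P := by
      rw [Fintype.sum_prod_type, ← hBC, ← hpair, sum_eq_single_of_mem 0 (mem_univ _)]
      · simp [z, b, c]
      · intro x _ hx; simp [z, hx]
    have e2 : ∑ v : K × K, a v.1 * z v.2 * c (-(v.1 + v.2)) = P := by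
      rw [Fintype.sum_prod_type_right, ← hAC, ← hpair, sum_eq_single_of_mem 0 (mem_univ _)]
      · simp [z, a, c]
      · intro x _ hx; simp [z, hx]
    have e3 : ∑ v : K × K, a v.1 * b v.2 * z (-(v.1 + v.2)) = P := by
      rw [Fintype.sum_prod_type, ← hAB, ← hpair]
      refine sum_congr rfl fun x _ => ?_
      rw [sum_eq_single_of_mem (-x) (mem_univ _)]
      · simp [z, a, b]
      · intro y _ hy
        have : ¬ -(x + y) = 0 := by
          contrapose! hy; exact eq_neg_of_add_eq_zero_right (neg_eq_zero.1 hy)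
        simp only [z, this, if_false, mul_zero]
    rw [sum_add_distrib, sum_add_distrib, e1, e2, e3]; ring
  have maaa : ∑ v : K × K, a v.1 * b v.2 * c (-(v.1 + v.2)) = T := by
    simp only [hT, zeroSumTriples, card_filter, Nat.cast_sum]
    refine sum_congr rfl fun v _ => ?_
    by_cases h1 : v.1 ∈ A <;> by_cases h2 : v.2 ∈ B <;> by_cases h3 : -(v.1 + v.2) ∈ C <;>
      simp only [a, b, c, h1, h2, h3] <;> simp
  have key : ∀ v : K × K,
      Φ ((if v.1 = 0 then 1 else 0) + (if v.2 = 0 then 1 else 0) +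
          (if -(v.1 + v.2) = 0 then 1 else 0))
        ((if v.1 ∈ A then 1 else 0) + (if v.2 ∈ B then 1 else 0) +
          (if -(v.1 + v.2) ∈ C then 1 else 0)) =
      Φ 0 0 * 1 +
      (Φ 1 0 - Φ 0 0) * (z v.1 + z v.2 + z (-(v.1 + v.2))) +
      (Φ 0 1 - Φ 0 0) * (a v.1 + b v.2 + c (-(v.1 + v.2))) +
      (Φ 0 2 - 2 * Φ 0 1 + Φ 0 0) *
        (a v.1 * b v.2 + a v.1 * c (-(v.1 + v.2)) + b v.2 * c (-(v.1 + v.2))) +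
      (Φ 1 1 - Φ 1 0 - Φ 0 1 + Φ 0 0) *
        (z v.1 * b v.2 + z v.1 * c (-(v.1 + v.2)) + a v.1 * z v.2 +
      z v.2 * c (-(v.1 + v.2)) + a v.1 * z (-(v.1 + v.2)) + b v.2 * z (-(v.1 + v.2))) +
      (Φ 3 0 - 3 * Φ 1 0 + 2 * Φ 0 0) * (z v.1 * z v.2) +
      (Φ 1 2 - 2 * Φ 1 1 + Φ 1 0 - Φ 0 2 + 2 * Φ 0 1 - Φ 0 0) *
        (z v.1 * b v.2 * c (-(v.1 + v.2)) + a v.1 * z v.2 * c (-(v.1 + v.2)) +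
      a v.1 * b v.2 * z (-(v.1 + v.2))) +
      (Φ 0 3 - 3 * Φ 0 2 + 3 * Φ 0 1 - Φ 0 0) * (a v.1 * b v.2 * c (-(v.1 + v.2))) := by
    rintro ⟨x, y⟩
    obtain ⟨w, hw⟩ : ∃ w, w = -(x + y) := ⟨_, rfl⟩
    simp only [← hw]
    by_cases hx : x = 0 <;> by_cases hy : y = 0
    · have : w = 0 := by rw [hw, hx, hy]; simp
      subst hx hy this
      simp only [z, a, b, c, hA0, hB0, hC0, if_true, if_false]; ring
    · have hw0 : w ≠ 0 := by rw [hw, hx]; simpa using hy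
      subst hx
      by_cases h2 : y ∈ B <;> by_cases h3 : w ∈ C <;>
        simp only [z, a, b, c, hA0, h2, h3, hy, hw0, if_true, if_false] <;> ring
    · have hw0 : w ≠ 0 := by rw [hw, hy]; simpa using hx
      subst hy
      by_cases h2 : x ∈ A <;> by_cases h3 : w ∈ C <;>
        simp only [z, a, b, c, hB0, h2, h3, hx, hw0, if_true, if_false] <;> ring
    · by_cases hw0 : w = 0
      · by_cases h2 : x ∈ A <;> by_cases h3 : y ∈ B <;>
          simp only [z, a, b, c, hC0, h2, h3, hx, hy, hw0, if_true, if_false] <;> ring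
      · by_cases h1 : x ∈ A <;> by_cases h2 : y ∈ B <;> by_cases h3 : w ∈ C <;>
          simp only [z, a, b, c, h1, h2, h3, hx, hy, hw0, if_true, if_false] <;> ring
  rw [sum_congr rfl fun v _ => key v]
  rw [sum_add_distrib, sum_add_distrib, sum_add_distrib, sum_add_distrib, sum_add_distrib,
    sum_add_distrib, sum_add_distrib]
  simp only [← mul_sum]
  rw [m0, mz, ma, maa, mza, mzz, mzaa, maaa]
  ring

end

variable {K : Type*} [Field K] [Fintype K] [DecidableEq K]

/-- Zero-sum triples are counted by the sum of the products of three Fourier transforms. -/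
lemma sum_prod_fourier {ψ : AddChar K ℂ} (hψ : ψ ≠ 1) (A B C : Finset K) :
    ∑ z, (∑ x ∈ A, ψ (x * z)) * (∑ x ∈ B, ψ (x * z)) * (∑ x ∈ C, ψ (x * z)) =
      Fintype.card K * #(zeroSumTriples A B C) := by
  have h : ∀ z, (∑ x ∈ A, ψ (x * z)) * (∑ x ∈ B, ψ (x * z)) * (∑ x ∈ C, ψ (x * z)) =
      ∑ v ∈ A ×ˢ B, ∑ w ∈ C, ψ (z * (v.1 + v.2 + w)) := by
    intro z
    rw [sum_mul_sum, ← sum_product', sum_mul_sum]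
    refine sum_congr rfl fun v _ => sum_congr rfl fun w _ => ?_
    rw [← AddChar.map_add_eq_mul, ← AddChar.map_add_eq_mul]; congr 1; ring
  simp_rw [h]
  rw [sum_comm]
  simp_rw [sum_comm (s := univ), sum_addChar_mul hψ]
  have e : ∀ v : K × K, (∑ w ∈ C, if v.1 + v.2 + w = 0 then (Fintype.card K : ℂ) else 0) =
      if -(v.1 + v.2) ∈ C then (Fintype.card K : ℂ) else 0 := by
    intro v
    have : ∀ w, v.1 + v.2 + w = 0 ↔ -(v.1 + v.2) = w := fun w => by
      rw [neg_eq_iff_add_eq_zero]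
    simp_rw [this, sum_ite_eq]
  simp_rw [e]
  rw [← sum_filter, sum_const, nsmul_eq_mul, mul_comm]
  congr 3
  ext v
  simp [zeroSumTriples, and_assoc]

/-- The set of all `x` for which `g * x` is a nonzero cube, where `3 * N + 1 = #K`. -/
def cubeCoset (N : ℕ) (g : K) : Finset K := {x | (g * x) ^ N = 1}

lemma mem_cubeCoset {N : ℕ} {g x : K} : x ∈ cubeCoset N g ↔ (g * x) ^ N = 1 := by
  simp [cubeCoset]

section

variable {N : ℕ} (hN : 3 * N + 1 = Fintype.card K) {g : K} (hg0 : g ≠ 0)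
include hN

lemma zero_notMem_cubeCoset : (0 : K) ∉ cubeCoset N g := by
  rw [mem_cubeCoset, mul_zero]
  exact zero_pow_ne_one hN

include hg0

lemma sum_cubeCoset (G : K → ℂ) :
    ∑ x ∈ cubeCoset N g, G x = ∑ x ∈ cubeClass K N, G (g ^ 2 * x) := by
  rw [cubeCoset, cubeClass, sum_filter, sum_filter]
  refine (Fintype.sum_equiv (Equiv.mulLeft₀ (g ^ 2) (pow_ne_zero 2 hg0)) _ _ fun x => ?_).symm
  have : (g * (g ^ 2 * x)) ^ N = x ^ N := by
    rw [show g * (g ^ 2 * x) = g ^ 3 * x by ring, mul_pow, ← pow_mul, mul_comm 3, pow_mul,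
      pow_pow_three hN hg0, one_mul]
  simp [this]

lemma card_cubeCoset {a : K} (ha0 : a ≠ 0) (ha : a ^ N ≠ 1) : #(cubeCoset N g) = N := by
  have h := sum_cubeCoset hN hg0 (fun _ => 1)
  simp only [sum_const, nsmul_eq_mul, mul_one, card_cubeClass hN ha0 ha] at h
  exact_mod_cast h

end

/-- The third moment of the periods counts zero-sum triples with entries in prescribed cubic
classes. -/
lemma card_mul_card_zeroSumTriples {N : ℕ} (hN : 3 * N + 1 = Fintype.card K) {ψ : AddChar K ℂ}
    (hψ : ψ ≠ 1) {a g : K} (ha0 : a ≠ 0) (ha : a ^ N ≠ 1) (hg0 : g ≠ 0) :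
    (Fintype.card K : ℂ) *
        #(zeroSumTriples (cubeCoset N 1) (cubeCoset N g) (cubeCoset N (g ^ 2))) =
      N ^ 3 + ∑ x ∈ cubeClass K N,
        (period ψ N x * period ψ N (g * x) * period ψ N (g ^ 2 * x) +
        period ψ N (a * x) * period ψ N (g * (a * x)) * period ψ N (g ^ 2 * (a * x)) +
        period ψ N (a ^ 2 * x) * period ψ N (g * (a ^ 2 * x)) *
          period ψ N (g ^ 2 * (a ^ 2 * x))) := by
  have hp' : ∀ b : K, b ≠ 0 → ∀ z,
      ∑ x ∈ cubeCoset N b, ψ (x * z) = period ψ N (b ^ 2 * z) := by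
    intro b hb z
    rw [sum_cubeCoset hN hb, period]
    refine sum_congr rfl fun x _ => ?_
    congr 1; ring
  have hg3 : (g ^ 3) ^ N = 1 := by rw [← pow_mul, mul_comm, pow_mul, pow_pow_three hN hg0]
  have hg4 : ∀ z, period ψ N ((g ^ 2) ^ 2 * z) = period ψ N (g * z) := fun z => by
    rw [← period_mul ψ (pow_ne_zero 3 hg0) hg3 (g * z)]; congr 1; ring
  rw [← sum_prod_fourier hψ]
  simp_rw [hp' 1 one_ne_zero, hp' g hg0, hp' (g ^ 2) (pow_ne_zero 2 hg0), hg4, one_pow, one_mul]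
  rw [sum_eq_zero_add_sum_cubeClass hN ha0 ha]
  simp only [mul_zero, period_zero, card_cubeClass hN ha0 ha]
  congr 1
  · ring
  · refine sum_congr rfl fun x _ => ?_
    ring

omit [Field K] [DecidableEq K] in
lemma card_eq_sq {p k : ℕ} (hk : Fintype.card K = p ^ (2 * k)) :
    (Fintype.card K : ℝ) = ((-p : ℝ) ^ k) ^ 2 := by
  rw [hk, ← pow_mul, mul_comm k, pow_mul (-(p : ℝ)), neg_sq, pow_mul]; push_cast; ring

section

variable {N : ℕ} (hN : 3 * N + 1 = Fintype.card K) {ψ : AddChar K ℂ} (hψ : ψ ≠ 1) {p k : ℕ}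
  [Fact p.Prime] [CharP K p]
  (hp : p % 3 = 2) (hk : Fintype.card K = p ^ (2 * k)) (hψp : ∀ x, ψ (x ^ p) = ψ x)
  {a : K} (ha0 : a ≠ 0) (ha : a ^ N ≠ 1)
include hN hψ hp hk hψp ha0 ha

/-- The three values of the cubic Gaussian periods in characteristic `2` modulo `3`. -/
lemma period_eq_ite (y : K) :
    period ψ N y = ((if y = 0 then (N : ℝ) else if y ^ N = 1 then (-1 - 2 * (-p) ^ k) / 3
      else ((-p) ^ k - 1) / 3 : ℝ) : ℂ) := by
  split_ifs with hy hyN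
  · rw [hy, period_zero, card_cubeClass hN ha0 ha]; simp
  · have h := period_of_noncube hψ hN hp hk hψp ha0 ha
    have h1 := (sq_period_of_noncube hψ hN hp hψp ha0 ha).1
    have h2 := period_mul ψ hy hyN 1
    rw [mul_one] at h2
    rw [h2, h1]
    push_cast
    linear_combination (-2 / 3 : ℂ) * h
  · have h := period_of_noncube hψ hN hp hk hψp hy hyN
    push_cast
    linear_combination (1 / 3 : ℂ) * h

/-- The number of triples of nonzero cubes of sum zero. -/
lemma card_zeroSumTriples_of_cube {g : K} (hg0 : g ≠ 0) (hg : g ^ N = 1) :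
    (#(zeroSumTriples (cubeCoset N 1) (cubeCoset N g) (cubeCoset N (g ^ 2))) : ℝ) =
      (Fintype.card K - 1) / 27 * (Fintype.card K - 8 - 2 * (-p) ^ k) := by
  have h := card_mul_card_zeroSumTriples hN hψ ha0 ha hg0
  have hsq := card_eq_sq hk
  have hg2 : (g ^ 2) ^ N = 1 := by rw [← pow_mul, mul_comm, pow_mul, hg, one_pow]
  have hc : (Fintype.card K : ℝ) = 3 * N + 1 := by rw [← hN]; push_cast; ring
  have hc0 : (Fintype.card K : ℝ) ≠ 0 := Nat.cast_ne_zero.2 Fintype.card_ne_zero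
  simp_rw [period_mul ψ hg0 hg, period_mul ψ (pow_ne_zero 2 hg0) hg2] at h
  rw [sum_congr rfl (g := fun _ => ((((-1 - 2 * (-p) ^ k) / 3) ^ 3 +
    2 * (((-p) ^ k - 1) / 3) ^ 3 : ℝ) : ℂ))] at h
  · rw [sum_const, nsmul_eq_mul, card_cubeClass hN ha0 ha] at h
    apply mul_left_cancel₀ hc0
    apply Complex.ofReal_injective
    rw [Complex.ofReal_mul, Complex.ofReal_natCast, Complex.ofReal_natCast, h,
      ← Complex.ofReal_natCast N, ← Complex.ofReal_pow, ← Complex.ofReal_mul,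
      ← Complex.ofReal_add]
    congr 1
    generalize (-(p : ℝ)) ^ k = S at *
    have hn : (N : ℝ) = (S ^ 2 - 1) / 3 := by rw [← hsq, hc]; ring
    rw [hsq, hn]; ring
  · intro x hx
    have hxN := mem_cubeClass.1 hx
    have hx0 : x ≠ 0 := by rintro rfl; exact zero_pow_ne_one hN hxN
    obtain ⟨-, h1, h2⟩ := (trichotomy hN ha0 ha hx0).resolve_right (by simp [hxN])
    simp only [period_eq_ite hN hψ hp hk hψp ha0 ha, hxN, h1, h2, hx0, ha0, mul_eq_zero, or_self,
      pow_eq_zero_iff, two_ne_zero, ne_eq, not_false_eq_true, if_true, if_false]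
    push_cast
    ring

/-- The number of triples of sum zero with one entry in each cubic class. -/
lemma card_zeroSumTriples_of_noncube {g : K} (hg0 : g ≠ 0) (hg : g ^ N ≠ 1) :
    (#(zeroSumTriples (cubeCoset N 1) (cubeCoset N g) (cubeCoset N (g ^ 2))) : ℝ) =
      (Fintype.card K - 1) / 27 * (Fintype.card K + 1 - 2 * (-p) ^ k) := by
  have h := card_mul_card_zeroSumTriples hN hψ ha0 ha hg0
  have hsq := card_eq_sq hk
  have hc : (Fintype.card K : ℝ) = 3 * N + 1 := by rw [← hN]; push_cast; ring
  have hc0 : (Fintype.card K : ℝ) ≠ 0 := Nat.cast_ne_zero.2 Fintype.card_ne_zero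
  have hval : ∀ y : K, y ≠ 0 → period ψ N y * period ψ N (g * y) * period ψ N (g ^ 2 * y) =
      (((-1 - 2 * (-p) ^ k) / 3 * (((-p) ^ k - 1) / 3) ^ 2 : ℝ) : ℂ) := by
    intro y hy
    rcases trichotomy hN hg0 hg hy with ⟨h1, h2, h3⟩ | ⟨h1, h2, h3⟩ | ⟨h1, h2, h3⟩ <;>
    · simp only [period_eq_ite hN hψ hp hk hψp ha0 ha, h1, h2, h3, hy, hg0, mul_eq_zero, or_self,
        pow_eq_zero_iff, two_ne_zero, ne_eq, not_false_eq_true, if_true, if_false]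
      push_cast
      ring
  rw [sum_congr rfl (g := fun _ => ((3 * ((-1 - 2 * (-p) ^ k) / 3 *
    (((-p) ^ k - 1) / 3) ^ 2) : ℝ) : ℂ))] at h
  · rw [sum_const, nsmul_eq_mul, card_cubeClass hN ha0 ha] at h
    apply mul_left_cancel₀ hc0
    apply Complex.ofReal_injective
    rw [Complex.ofReal_mul, Complex.ofReal_natCast, Complex.ofReal_natCast, h,
      ← Complex.ofReal_natCast N, ← Complex.ofReal_pow, ← Complex.ofReal_mul,
      ← Complex.ofReal_add]
    congr 1
    generalize (-(p : ℝ)) ^ k = S at *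
    have hn : (N : ℝ) = (S ^ 2 - 1) / 3 := by rw [← hsq, hc]; ring
    rw [hsq, hn]; ring
  · intro x hx
    have hxN := mem_cubeClass.1 hx
    have hx0 : x ≠ 0 := by rintro rfl; exact zero_pow_ne_one hN hxN
    rw [hval x hx0, hval _ (mul_ne_zero ha0 hx0), hval _ (mul_ne_zero (pow_ne_zero 2 ha0) hx0)]
    push_cast
    ring

end

end

/-! ### Hamming weights as Gaussian periods -/

section

lemma pow_gcd_mem {G : Type*} [Group G] (H : Subgroup G) {a : G} {m n : ℕ} (hm : a ^ m ∈ H)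
    (hn : a ^ n ∈ H) : a ^ m.gcd n ∈ H := by
  rw [← zpow_natCast, Nat.gcd_eq_gcd_ab, zpow_add, zpow_mul, zpow_mul, zpow_natCast, zpow_natCast]
  exact H.mul_mem (H.zpow_mem hm _) (H.zpow_mem hn _)

lemma sum_range_three_mul {M : Type*} [AddCommMonoid M] (f : ℕ → M) (n : ℕ) :
    ∑ i ∈ range (3 * n), f i = ∑ j ∈ range n, (f (3 * j) + f (3 * j + 1) + f (3 * j + 2)) := by
  induction n with
  | zero => simp
  | succ n ih =>
    rw [show 3 * (n + 1) = 3 * n + 1 + 1 + 1 by ring, sum_range_succ, sum_range_succ,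
      sum_range_succ, ih, sum_range_succ, add_assoc, add_assoc, add_assoc]

section

variable {K : Type*} [Field K] [Fintype K] {N : ℕ} (hN : 3 * N + 1 = Fintype.card K)
  {α : Kˣ} (hα : ∀ x : Kˣ, x ∈ Subgroup.zpowers α)
include hN hα

lemma orderOf_generator : orderOf α = 3 * N := by
  rw [orderOf_eq_card_of_forall_mem_zpowers hα, Nat.card_units, Nat.card_eq_fintype_card, ← hN,
    Nat.add_sub_cancel]

lemma generator_pow_pow_eq_one_iff (d : ℕ) : ((α : K) ^ d) ^ N = 1 ↔ 3 ∣ d := by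
  rw [← pow_mul, ← Units.val_pow_eq_pow_val, Units.val_eq_one, ← orderOf_dvd_iff_pow_eq_one,
    orderOf_generator hN hα]
  exact Nat.mul_dvd_mul_iff_right (pos_of_card hN)

/-- Every nonzero cube is a power of the cube of a generator. -/
lemma mem_of_pow_three_mem (H : Subgroup Kˣ) (h3 : α ^ 3 ∈ H) {x : Kˣ} (hx : (x : K) ^ N = 1) :
    x ∈ H := by
  obtain ⟨k, rfl⟩ := Subgroup.mem_zpowers_iff.1 (hα x)
  rw [← Units.val_pow_eq_pow_val, Units.val_eq_one, ← zpow_natCast, ← zpow_mul,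
    ← orderOf_dvd_iff_zpow_eq_one, orderOf_generator hN hα] at hx
  push_cast at hx
  have hk : (3 : ℤ) ∣ k :=
    Int.dvd_of_mul_dvd_mul_right (Int.natCast_ne_zero.2 (pos_of_card hN).ne') hx
  obtain ⟨c, rfl⟩ := hk
  rw [zpow_mul]
  exact H.zpow_mem (by exact_mod_cast h3) c

end

section

variable {F K : Type*} [Field F] [Fintype F] [Field K] [Fintype K] [DecidableEq K] [Algebra F K]
  {N M h d : ℕ} (hN : 3 * N + 1 = Fintype.card K) (hNM : N = (Fintype.card F - 1) * M)
  (hd : h * d = Fintype.card F - 1) (hgcd : Nat.gcd (3 * M) (3 * d) = 3)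
  {α : Kˣ} (hα : ∀ x : Kˣ, x ∈ Subgroup.zpowers α)
include hN hNM hd hgcd hα

/-- The products of the elements of `Fˣ` and the powers of `g ^ 3`, where `g = α ^ d`, run through
the nonzero cubes of `K` with constant multiplicity `h`: both factors together generate the group
of cubes because of the condition on the greatest common divisor. -/
lemma sum_sum_range_pow (ψ : AddChar K ℂ) (y : K) :
    ∑ l : F, ∑ j ∈ range (h * M), ψ (algebraMap F K l * (((α : K) ^ d) ^ 3) ^ j * y) =
      h * M + h * period ψ N y := by
  classical
  set E : K → ℂ := fun y =>
    ∑ l : F, ∑ j ∈ range (h * M), ψ (algebraMap F K l * (((α : K) ^ d) ^ 3) ^ j * y) with hE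
  have hN0 := pos_of_card hN
  have hF1 : 1 < Fintype.card F := Fintype.one_lt_card
  have hα0 : (α : K) ≠ 0 := α.ne_zero
  let H : Subgroup Kˣ :=
    { carrier := {u | ∀ y, E (u * y) = E y}
      one_mem' := fun y => by simp
      mul_mem' := fun {u v} hu hv y => by rw [Units.val_mul, mul_assoc, hu, hv]
      inv_mem' := fun {u} hu y => by rw [← hu, Units.mul_inv_cancel_left] }
  have hH : ∀ u : Kˣ, u ∈ H ↔ ∀ y, E (u * y) = E y := fun u => Iff.rfl
  have hM3 : (Fintype.card K - 1) / (Fintype.card F - 1) = 3 * M := by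
    rw [← hN, Nat.add_sub_cancel, hNM]
    exact Nat.div_eq_of_eq_mul_right (by omega) (by ring)
  have h1 : α ^ (3 * M) ∈ H := by
    rw [hH]
    intro y
    have hnorm : ((α ^ (3 * M) : Kˣ) : K) = algebraMap F K (Algebra.norm F (α : K)) := by
      rw [FiniteField.algebraMap_norm_eq_pow, Nat.card_eq_fintype_card, Nat.card_eq_fintype_card,
        hM3, Units.val_pow_eq_pow_val]
    have hl : Algebra.norm F (α : K) ≠ 0 := Algebra.norm_ne_zero_iff.2 hα0
    rw [hnorm]
    refine Fintype.sum_equiv (Equiv.mulLeft₀ _ hl) _ _ fun l => sum_congr rfl fun j _ => ?_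
    rw [Equiv.mulLeft₀_apply, map_mul (algebraMap F K)]
    congr 1; ring
  have h2 : α ^ (3 * d) ∈ H := by
    rw [hH]
    intro y
    refine sum_congr rfl fun l _ => ?_
    -- a cyclic shift of the exponents
    have hone : (((α : K) ^ d) ^ 3) ^ (h * M) = 1 := by
      have : α ^ (3 * N) = 1 := by rw [← orderOf_generator hN hα, pow_orderOf_eq_one]
      rw [← pow_mul, ← pow_mul, ← Units.val_pow_eq_pow_val, Units.val_eq_one, ← this, hNM, ← hd]
      congr 1; ring
    have hs := (sum_range_succ (fun j => ψ (algebraMap F K l * (((α : K) ^ d) ^ 3) ^ j * y))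
      (h * M)).symm.trans (sum_range_succ' _ _)
    rw [hone, pow_zero] at hs
    rw [add_right_cancel hs]
    refine sum_congr rfl fun j _ => ?_
    rw [Units.val_pow_eq_pow_val]
    congr 1; ring
  have h3 : α ^ 3 ∈ H := by
    have := pow_gcd_mem H h1 h2
    rwa [hgcd] at this
  have hinv : ∀ x ∈ cubeClass K N, E (x * y) = E y := by
    intro x hx
    have hxN := mem_cubeClass.1 hx
    have hx0 : x ≠ 0 := by rintro rfl; exact zero_pow_ne_one hN hxN
    exact (hH (Units.mk0 x hx0)).1 (mem_of_pow_three_mem hN hα H h3 hxN) y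
  have hαN : (α : K) ^ N ≠ 1 := by
    have := (generator_pow_pow_eq_one_iff hN hα 1).not.2 (by norm_num)
    rwa [pow_one] at this
  have hterm : ∀ l : F, ∑ j ∈ range (h * M), ∑ x ∈ cubeClass K N,
      ψ (algebraMap F K l * (((α : K) ^ d) ^ 3) ^ j * (x * y)) =
      if l = 0 then (h * M * N : ℂ) else h * M * period ψ N y := by
    intro l
    split_ifs with hl
    · simp [hl, card_cubeClass hN hα0 hαN]
    · rw [sum_congr rfl (g := fun _ => period ψ N y)]
      · simp
      · intro j _
        have hlN : (algebraMap F K l) ^ N = 1 := by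
          rw [hNM, pow_mul, ← map_pow, FiniteField.pow_card_sub_one_eq_one l hl, map_one, one_pow]
        have hl0 : algebraMap F K l ≠ 0 := (map_ne_zero _).2 hl
        have hgN : ((((α : K) ^ d) ^ 3) ^ j) ^ N = 1 := by
          rw [← pow_mul, mul_comm, pow_mul, ← pow_mul _ 3 N, mul_comm 3, pow_mul,
            pow_pow_three hN (pow_ne_zero d hα0), one_pow]
        have hg0 : (((α : K) ^ d) ^ 3) ^ j ≠ 0 := by positivity
        rw [← period_mul ψ hg0 hgN y, ← period_mul ψ hl0 hlN, period]
        refine sum_congr rfl fun x _ => ?_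
        congr 1; ring
  have hsum : (N : ℂ) * E y = h * M * N + (Fintype.card F - 1) * (h * M * period ψ N y) := by
    calc (N : ℂ) * E y = ∑ x ∈ cubeClass K N, E (x * y) := by
          rw [sum_congr rfl hinv, sum_const, card_cubeClass hN hα0 hαN, nsmul_eq_mul]
      _ = ∑ l : F, if l = 0 then (h * M * N : ℂ) else h * M * period ψ N y := by
          rw [hE, sum_comm]
          refine sum_congr rfl fun l _ => ?_
          rw [sum_comm, hterm]
      _ = _ := by
          rw [← add_sum_erase _ _ (mem_univ (0 : F)), if_pos rfl,
            sum_congr rfl (g := fun _ => h * M * period ψ N y)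
              (fun l hl => if_neg (ne_of_mem_erase hl)),
            sum_const, card_erase_of_mem (mem_univ _), card_univ, nsmul_eq_mul,
            Nat.cast_sub hF1.le, Nat.cast_one]
  have hNc : (N : ℂ) = (Fintype.card F - 1) * M := by
    rw [hNM, Nat.cast_mul, Nat.cast_sub hF1.le, Nat.cast_one]
  have hNc0 : (N : ℂ) ≠ 0 := Nat.cast_ne_zero.2 hN0.ne'
  apply mul_left_cancel₀ hNc0
  rw [hsum, hNc]
  ring

/-- The modified weight of a codeword as a sum of three Gaussian periods. -/
lemma modifiedWeight_codeword {χ : AddChar F ℂ} (hχ : χ ≠ 1) {ψ : AddChar K ℂ}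
    (hψχ : ∀ x, ψ x = χ (Algebra.trace F K x)) {q r : ℕ} (hq : Fintype.card F = q)
    (hr : Fintype.card K = r) (a b : K) :
    (modifiedWeight q r h (codeword F q r h 3 α a b) : ℂ) = h / q *
      (period ψ N (a + b) + period ψ N ((α : K) ^ d * (a + b * (α : K) ^ N)) +
        period ψ N (((α : K) ^ d) ^ 2 * (a + b * ((α : K) ^ N) ^ 2))) := by
  classical
  have hF1 : 1 < q := hq ▸ Fintype.one_lt_card
  have hα0 : (α : K) ≠ 0 := α.ne_zero
  rw [hq] at hNM hd
  rw [hr] at hN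
  have hr1 : r - 1 = 3 * N := by omega
  have hh : 0 < h := Nat.pos_of_ne_zero (by rintro rfl; omega)
  have hlen : codeLength q r h = 3 * (h * M) := by
    rw [codeLength, hr1, hNM]
    exact Nat.div_eq_of_eq_mul_right (by omega) (by ring)
  have hdiv : (q - 1) / h = d := Nat.div_eq_of_eq_mul_right hh hd.symm
  have hdiv3 : (r - 1) / 3 = N := by omega
  set c := codeword F q r h 3 α a b with hc
  have hcount : hammingNorm c + #{i | c i = 0} = 3 * (h * M) := by
    rw [hammingNorm, add_comm, card_filter_add_card_filter_not, card_univ, Fintype.card_fin, hlen]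
  have hβ3 : ((α : K) ^ N) ^ 3 = 1 := pow_pow_three (by rw [hr]; exact hN) hα0
  have hfun : ∀ i l, χ (l * c i) = ψ (algebraMap F K l * ((α : K) ^ d) ^ (i : ℕ) *
      (a + b * ((α : K) ^ N) ^ (i : ℕ))) := by
    intro i l
    rw [hψχ, hc, codeword, hdiv, hdiv3, ← smul_eq_mul l, ← map_smul]
    congr 2
    rw [Algebra.smul_def]
    ring
  have hzero : (q : ℂ) * #{i | c i = 0} = 3 * (h * M) + h * (period ψ N (a + b) +
      period ψ N ((α : K) ^ d * (a + b * (α : K) ^ N)) +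
      period ψ N (((α : K) ^ d) ^ 2 * (a + b * ((α : K) ^ N) ^ 2))) := by
    calc (q : ℂ) * #{i | c i = 0} = ∑ i, ∑ l, χ (l * c i) := by
          simp_rw [sum_addChar_mul hχ, hq, ← sum_filter]
          rw [sum_const, nsmul_eq_mul, mul_comm]
      _ = ∑ l, ∑ i ∈ range (3 * (h * M)), ψ (algebraMap F K l * ((α : K) ^ d) ^ i *
            (a + b * ((α : K) ^ N) ^ i)) := by
          rw [sum_comm, ← hlen]
          refine sum_congr rfl fun l _ => ?_
          rw [sum_range]
          exact sum_congr rfl fun i _ => hfun i l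
      _ = ∑ l : F, ∑ j ∈ range (h * M), (
            ψ (algebraMap F K l * (((α : K) ^ d) ^ 3) ^ j * (a + b)) +
            ψ (algebraMap F K l * (((α : K) ^ d) ^ 3) ^ j *
              ((α : K) ^ d * (a + b * (α : K) ^ N))) +
            ψ (algebraMap F K l * (((α : K) ^ d) ^ 3) ^ j *
              (((α : K) ^ d) ^ 2 * (a + b * ((α : K) ^ N) ^ 2)))) := by
          refine sum_congr rfl fun l _ => ?_
          rw [sum_range_three_mul]
          refine sum_congr rfl fun j _ => ?_
          simp only [pow_add, pow_mul _ 3 j, hβ3, one_pow, mul_one, one_mul, pow_one]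
          congr 2 <;> ring_nf
      _ = _ := by
          rw [← hr] at hN
          rw [← hq] at hNM hd
          simp only [sum_add_distrib]
          rw [sum_sum_range_pow hN hNM hd hgcd hα, sum_sum_range_pow hN hNM hd hgcd hα,
            sum_sum_range_pow hN hNM hd hgcd hα]
          ring
  have hq0 : (q : ℂ) ≠ 0 := Nat.cast_ne_zero.2 (by omega)
  have hcount' : (hammingNorm c : ℂ) + #{i | c i = 0} = 3 * (h * M) := by exact_mod_cast hcount
  have hrc : (r : ℂ) - 1 = 3 * ((q - 1) * M) := by
    have : (N : ℂ) = (q - 1) * M := by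
      rw [hNM, Nat.cast_mul, Nat.cast_sub hF1.le, Nat.cast_one]
    rw [← this, ← hN]; push_cast; ring
  have hmw : (modifiedWeight q r h c : ℂ) = h * (r - 1) / q - hammingNorm c := by
    rw [modifiedWeight]
    push_cast
    congr!
  rw [hmw, hrc]
  apply mul_left_cancel₀ hq0
  rw [← mul_assoc (q : ℂ), mul_div_cancel₀ _ hq0, mul_sub, mul_div_cancel₀ _ hq0]
  linear_combination (-q : ℂ) * hcount' + hzero

end

/-- A Frobenius-invariant nontrivial additive character of `K` that factors through the trace to
`F`. -/
lemma exists_addChar (F K : Type*) [Field F] [Finite F] [Field K] [Finite K] [Algebra F K]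
    (p : ℕ) [Fact p.Prime] [CharP F p] :
    ∃ (χ : AddChar F ℂ) (ψ : AddChar K ℂ), χ ≠ 1 ∧ ψ ≠ 1 ∧
      (∀ x, ψ x = χ (Algebra.trace F K x)) ∧ ∀ x, ψ (x ^ p) = ψ x := by
  have : CharP K p := charP_of_injective_algebraMap (algebraMap F K).injective p
  let _ := ZMod.algebra F p
  let _ := ZMod.algebra K p
  have : IsScalarTower (ZMod p) F K := IsScalarTower.of_algebraMap_eq' (Subsingleton.elim _ _)
  let e : AddChar (ZMod p) ℂ := ZMod.stdAddChar
  have he : ∃ x, e x ≠ 1 := by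
    by_contra! hcon
    have h := ZMod.isPrimitive_stdAddChar p (one_ne_zero (α := ZMod p))
    apply h
    ext x
    simpa [AddChar.mulShift_apply] using hcon x
  obtain ⟨x0, hx0⟩ := he
  obtain ⟨y0, rfl⟩ := Algebra.trace_surjective (ZMod p) F x0
  obtain ⟨z0, rfl⟩ := Algebra.trace_surjective F K y0
  let χ : AddChar F ℂ := e.compAddMonoidHom (Algebra.trace (ZMod p) F).toAddMonoidHom
  let ψ : AddChar K ℂ := χ.compAddMonoidHom (Algebra.trace F K).toAddMonoidHom
  have hχ : ∀ x, χ x = e (Algebra.trace (ZMod p) F x) := fun x => rfl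
  have hψ : ∀ x, ψ x = χ (Algebra.trace F K x) := fun x => rfl
  refine ⟨χ, ψ, fun h => hx0 ?_, fun h => hx0 ?_, hψ, fun x => ?_⟩
  · rw [← hχ, h]; rfl
  · rw [← hχ, ← hψ, h]; rfl
  · rw [hψ, hψ, hχ, hχ, Algebra.trace_trace, Algebra.trace_trace]
    have h := Algebra.trace_eq_of_algEquiv
      (FiniteField.frobeniusAlgEquivOfAlgebraic (ZMod p) K) x
    rw [FiniteField.coe_frobeniusAlgEquivOfAlgebraic, ZMod.card] at h
    exact congrArg e h

end

/-! ### The weight distribution -/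

section

variable {K : Type*} [Field K] [Fintype K] [DecidableEq K]

/-- The number of zeros among `v.1`, `v.2`, `-(v.1 + v.2)`. -/
def zeroCount (v : K × K) : ℕ :=
  (if v.1 = 0 then 1 else 0) + (if v.2 = 0 then 1 else 0) + (if -(v.1 + v.2) = 0 then 1 else 0)

/-- The number of nonzero cubes among `v.1`, `g * v.2`, `-g ^ 2 * (v.1 + v.2)`. -/
def cubeCount (N : ℕ) (g : K) (v : K × K) : ℕ :=
  (if v.1 ∈ cubeCoset N 1 then 1 else 0) + (if v.2 ∈ cubeCoset N g then 1 else 0) +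
    (if -(v.1 + v.2) ∈ cubeCoset N (g ^ 2) then 1 else 0)

/-- The modified weight of a codeword that gives rise to `i` zeros, `j` nonzero cubes and
`3 - i - j` noncubes. -/
noncomputable def patternWeight (q h N S : ℝ) (i j : ℕ) : ℝ :=
  h / q * (i * N + j * ((-1 - 2 * S) / 3) + (3 - i - j) * ((S - 1) / 3))

/-- The weights occurring in the tables. -/
lemma patternWeight_values (q h r S : ℝ) :
    patternWeight q h ((r - 1) / 3) S 0 3 = -(h / q) * (2 * S + 1) ∧
    patternWeight q h ((r - 1) / 3) S 0 0 = h / q * (S - 1) ∧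
    patternWeight q h ((r - 1) / 3) S 0 2 = -(h / q) * (S + 1) ∧
    patternWeight q h ((r - 1) / 3) S 0 1 = -(h / q) ∧
    patternWeight q h ((r - 1) / 3) S 1 2 = h / (3 * q) * (r - 4 * S - 3) ∧
    patternWeight q h ((r - 1) / 3) S 1 0 = h / (3 * q) * (r + 2 * S - 3) ∧
    patternWeight q h ((r - 1) / 3) S 1 1 = h / (3 * q) * (r - S - 3) ∧
    patternWeight q h ((r - 1) / 3) S 3 0 = h * (r - 1) / q := by
  simp only [patternWeight]
  push_cast
  refine ⟨?_, ?_, ?_, ?_, ?_, ?_, ?_, ?_⟩ <;> ring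

variable {N : ℕ} (hN : 3 * N + 1 = Fintype.card K)
include hN

lemma zeroCount_add_cubeCount_le {g : K} (v : K × K) : zeroCount v + cubeCount N g v ≤ 3 := by
  have h : ∀ g x : K, (if x = 0 then 1 else 0) + (if x ∈ cubeCoset N g then 1 else 0) ≤ 1 := by
    intro g x
    by_cases hx : x = 0
    · simp [hx, zero_notMem_cubeCoset hN]
    · split_ifs <;> simp
  have h1 := h 1 v.1
  have h2 := h g v.2
  have h3 := h (g ^ 2) (-(v.1 + v.2))
  unfold zeroCount cubeCount
  omega

lemma card_cubeCoset_filter_neg_of_cube {b c : K} (hb0 : b ≠ 0) (hb : b ^ N = 1) (hc : c ^ N = 1)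
    {a : K} (ha0 : a ≠ 0) (ha : a ^ N ≠ 1) :
    #{x ∈ cubeCoset N b | -x ∈ cubeCoset N c} = N := by
  rw [filter_true_of_mem, card_cubeCoset hN hb0 ha0 ha]
  intro x hx
  rw [mem_cubeCoset, mul_pow, hb, one_mul] at hx
  rw [mem_cubeCoset, mul_pow, hc, one_mul, neg_pow_eq hN, hx]

lemma card_cubeCoset_filter_neg_of_ne {b c : K} (hbc : b ^ N ≠ c ^ N) :
    #{x ∈ cubeCoset N b | -x ∈ cubeCoset N c} = 0 := by
  rw [card_eq_zero, filter_eq_empty_iff]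
  intro x hx hx'
  have hx0 : x ≠ 0 := by rintro rfl; exact zero_notMem_cubeCoset hN hx
  rw [mem_cubeCoset, mul_pow] at hx hx'
  rw [neg_pow_eq hN] at hx'
  exact hbc (mul_right_cancel₀ (pow_ne_zero N hx0) (hx.trans hx'.symm))

end

section

variable {F K : Type*} [Field F] [Fintype F] [Field K] [Fintype K] [DecidableEq K] [Algebra F K]
  {N M h d : ℕ} (hN : 3 * N + 1 = Fintype.card K) (hNM : N = (Fintype.card F - 1) * M)
  (hd : h * d = Fintype.card F - 1) (hgcd : Nat.gcd (3 * M) (3 * d) = 3)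
  {α : Kˣ} (hα : ∀ x : Kˣ, x ∈ Subgroup.zpowers α) (h3 : 3 ∣ N)
  {χ : AddChar F ℂ} (hχ : χ ≠ 1) {ψ : AddChar K ℂ} (hψ : ψ ≠ 1)
  (hψχ : ∀ x, ψ x = χ (Algebra.trace F K x)) {q r : ℕ} (hq : Fintype.card F = q)
  (hr : Fintype.card K = r) {p k : ℕ} [Fact p.Prime] [CharP K p]
  (hp : p % 3 = 2) (hk : Fintype.card K = p ^ (2 * k)) (hψp : ∀ x, ψ (x ^ p) = ψ x)

omit [DecidableEq K] in
include hN hα in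
lemma generator_pow_ne_one : (α : K) ^ N ≠ 1 := by
  have := (generator_pow_pow_eq_one_iff hN hα 1).not.2 (by norm_num)
  rwa [pow_one] at this

/-- The change of variables `(a, b) ↦ (a + b, β (a + b β))`, whose third companion is
`-(a + b) - β (a + b β) = β² (a + b β²)`. -/
def zeroSumCoords (β : K) (v : K × K) : K × K := (v.1 + v.2, β * (v.1 + v.2 * β))

omit [Fintype K] [DecidableEq K] in
lemma zeroSumCoords_injective {β : K} (hβ0 : β ≠ 0) (hβ : β ≠ 1) :
    Function.Injective (zeroSumCoords β) := by
  rintro ⟨a, b⟩ ⟨a', b'⟩ heq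
  simp only [zeroSumCoords, Prod.mk.injEq] at heq
  have h2 := mul_left_cancel₀ hβ0 heq.2
  have hb : b = b' := by
    have : (β - 1) * b = (β - 1) * b' := by linear_combination h2 - heq.1
    exact mul_left_cancel₀ (sub_ne_zero.2 hβ) this
  subst hb
  simpa using heq.1

include hN hψ hp hk hψp in
lemma period_mul_eq {a : K} (ha0 : a ≠ 0) (ha : a ^ N ≠ 1) {g : K} (hg0 : g ≠ 0) (x : K) :
    period ψ N (g * x) = (((if x = 0 then 1 else 0 : ℕ) : ℝ) * N +
      ((if x ∈ cubeCoset N g then 1 else 0 : ℕ) : ℝ) * ((-1 - 2 * (-p) ^ k) / 3) +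
      (1 - ((if x = 0 then 1 else 0 : ℕ) : ℝ) - ((if x ∈ cubeCoset N g then 1 else 0 : ℕ) : ℝ)) *
        (((-p) ^ k - 1) / 3) : ℝ) := by
  rw [period_eq_ite hN hψ hp hk hψp ha0 ha]
  congr 1
  by_cases hx : x = 0
  · subst hx
    simp [zero_notMem_cubeCoset hN]
  · have hgx : g * x ≠ 0 := mul_ne_zero hg0 hx
    by_cases hc : (g * x) ^ N = 1 <;> simp [mem_cubeCoset, hx, hgx, hc]

include hN hNM hd hgcd hα h3 hχ hψ hψχ hq hr hp hk hψp

/-- The modified weight of `c(a, b)` depends only on the zeros and cubes among the coordinates of the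
zero-sum triple attached to `(a, b)`. -/
lemma modifiedWeight_codeword_eq (v : K × K) :
    modifiedWeight q r h (codeword F q r h 3 α v.1 v.2) =
      patternWeight q h N ((-p) ^ k) (zeroCount (zeroSumCoords ((α : K) ^ N) v))
        (cubeCount N ((α : K) ^ d) (zeroSumCoords ((α : K) ^ N) v)) := by
  have hα0 : (α : K) ≠ 0 := α.ne_zero
  have hαN := generator_pow_ne_one hN hα
  have hβ := (generator_pow_pow_eq_one_iff hN hα N).2 h3
  have hβ0 : (α : K) ^ N ≠ 0 := pow_ne_zero N hα0
  have hβsum := one_add_pow_add_sq hN hα0 hαN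
  have hg0 : (α : K) ^ d ≠ 0 := pow_ne_zero d hα0
  have hval := fun {g : K} => period_mul_eq hN hψ hp hk hψp hα0 hαN (g := g)
  apply Complex.ofReal_injective
  rw [modifiedWeight_codeword hN hNM hd hgcd hα hχ hψχ hq hr]
  generalize (α : K) ^ N = β at *
  have e0 : period ψ N (v.1 + v.2) = period ψ N (1 * (zeroSumCoords β v).1) := by
    rw [one_mul, zeroSumCoords]
  -- the cube roots of unity are themselves cubes, so that multiplication by them is harmless
  have e1 : period ψ N ((α : K) ^ d * (v.1 + v.2 * β)) =
      period ψ N ((α : K) ^ d * (zeroSumCoords β v).2) := by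
    rw [← period_mul ψ hβ0 hβ, zeroSumCoords]; congr 1; ring
  have e2 : period ψ N (((α : K) ^ d) ^ 2 * (v.1 + v.2 * β ^ 2)) =
      period ψ N (((α : K) ^ d) ^ 2 * -((zeroSumCoords β v).1 + (zeroSumCoords β v).2)) := by
    rw [← period_mul ψ hβ0 hβ, ← period_mul ψ hβ0 hβ, zeroSumCoords]
    congr 1
    linear_combination ((α : K) ^ d) ^ 2 * (v.1 + v.2 * β ^ 2 + v.2 * (1 - β)) * hβsum
  rw [e0, e1, e2]
  generalize zeroSumCoords β v = u
  rw [hval one_ne_zero, hval hg0, hval (pow_ne_zero 2 hg0)]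
  simp only [patternWeight, zeroCount, cubeCount]
  push_cast
  ring

/-- The zero word has modified weight `3 * N * h / q`, and by the bounds on the periods only three
zero arguments attain it. -/
lemma codeword_injective :
    Function.Injective fun ab : K × K => codeword F q r h 3 α ab.1 ab.2 := by
  have hα0 : (α : K) ≠ 0 := α.ne_zero
  have hαN := generator_pow_ne_one hN hα
  have hβ0 : (α : K) ^ N ≠ 0 := pow_ne_zero N hα0
  have hF1 : 1 < Fintype.card F := Fintype.one_lt_card
  have hq0 : (0 : ℝ) < q := by rw [← hq]; exact_mod_cast hF1.le
  have hh : (0 : ℝ) < h := by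
    rw [Nat.cast_pos]
    exact Nat.pos_of_ne_zero (by rintro rfl; omega)
  have hker : ∀ v : K × K, codeword F q r h 3 α v.1 v.2 = 0 → v = 0 := by
    intro v hv
    have hw := modifiedWeight_codeword_eq hN hNM hd hgcd hα h3 hχ hψ hψχ hq hr hp hk hψp v
    have hle := zeroCount_add_cubeCount_le (g := (α : K) ^ d) hN
      (zeroSumCoords ((α : K) ^ N) v)
    rw [hv] at hw
    have hmw : modifiedWeight q r h (0 : Fin (codeLength q r h) → F) = h * (r - 1) / q := by
      simp [modifiedWeight]
    have hS := card_eq_sq hk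
    have hN3 : 3 ≤ N := Nat.le_of_dvd (pos_of_card hN) h3
    have hN3' : (3 : ℝ) ≤ N := by exact_mod_cast hN3
    have hc : (Fintype.card K : ℝ) = 3 * N + 1 := by rw [← hN]; push_cast; ring
    have hrr : (r : ℝ) = 3 * N + 1 := by rw [← hr, hc]
    rw [hmw, patternWeight, hrr] at hw
    rw [hc] at hS
    generalize (-(p : ℝ)) ^ k = S at hw hS
    set i := zeroCount (zeroSumCoords ((α : K) ^ N) v) with hi
    set j := cubeCount N ((α : K) ^ d) (zeroSumCoords ((α : K) ^ N) v)
    have hle' : (i : ℝ) + j ≤ 3 := by exact_mod_cast hle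
    have hA : (0 : ℝ) < N - (S - 1) / 3 := by nlinarith [sq_nonneg (S - 1)]
    have hB : (0 : ℝ) < N - (-1 - 2 * S) / 3 := by nlinarith [sq_nonneg (S + 2)]
    have hsum : (j : ℝ) * (N - (-1 - 2 * S) / 3) + (3 - i - j) * (N - (S - 1) / 3) = 0 := by
      have hfac : (h / q : ℝ) ≠ 0 := (div_pos hh hq0).ne'
      apply mul_left_cancel₀ hfac
      have : (h * (3 * N + 1 - 1) / q : ℝ) = h / q * (3 * N) := by ring
      rw [this] at hw
      linear_combination hw
    have hj : (0 : ℝ) ≤ j := Nat.cast_nonneg j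
    have h1 : (j : ℝ) * (N - (-1 - 2 * S) / 3) = 0 := by
      have := mul_nonneg hj hB.le
      have := mul_nonneg (by linarith : (0 : ℝ) ≤ 3 - i - j) hA.le
      linarith
    have hj0 : (j : ℝ) = 0 := (mul_eq_zero.1 h1).resolve_right hB.ne'
    have h2 : (3 - i - j : ℝ) * (N - (S - 1) / 3) = 0 := by linarith
    have hi3 : (i : ℝ) = 3 := by
      have := (mul_eq_zero.1 h2).resolve_right hA.ne'
      linarith
    have hi3' : i = 3 := by exact_mod_cast hi3
    have hv0 : zeroSumCoords ((α : K) ^ N) v = zeroSumCoords ((α : K) ^ N) 0 := by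
      rw [hi, zeroCount] at hi3'
      have z0 : zeroSumCoords ((α : K) ^ N) 0 = 0 := by simp [zeroSumCoords]
      rw [z0]
      split_ifs at hi3' with c1 c2 <;> first
        | exact Prod.ext c1 c2
        | omega
    exact zeroSumCoords_injective hβ0 hαN hv0
  intro v v' heq
  have := hker (v - v') (by
    ext i
    have := congrFun heq i
    simp only [codeword] at this
    simp only [codeword, Prod.fst_sub, Prod.snd_sub, Pi.zero_apply]
    rw [sub_mul, sub_mul, sub_add_sub_comm, map_sub, this, sub_self])
  exact sub_eq_zero.1 this

open Classical in
/-- The number of codewords of each modified weight, in terms of the number `P` of pairs of opposite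
elements in two of the cosets and of the number `T` of zero-sum triples. -/
lemma ncard_modifiedWeight_eq {P : ℕ}
    (h01 : #{x ∈ cubeCoset N (1 : K) | -x ∈ cubeCoset N ((α : K) ^ d)} = P)
    (h02 : #{x ∈ cubeCoset N (1 : K) | -x ∈ cubeCoset N (((α : K) ^ d) ^ 2)} = P)
    (h12 : #{x ∈ cubeCoset N ((α : K) ^ d) | -x ∈ cubeCoset N (((α : K) ^ d) ^ 2)} = P)
    {T : ℝ} (hT : T = #(zeroSumTriples (cubeCoset N (1 : K)) (cubeCoset N ((α : K) ^ d))
      (cubeCoset N (((α : K) ^ d) ^ 2)))) (w : ℝ) :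
    (({c | c ∈ cyclicCode F q r h 3 α ∧ modifiedWeight q r h c = w} : Set _).ncard : ℝ) =
      let Φ : ℕ → ℕ → ℝ := fun i j => if patternWeight q h N ((-p) ^ k) i j = w then 1 else 0
      Φ 3 0 + 3 * P * Φ 1 2 + (6 * N - 6 * P) * Φ 1 1 + (3 * r - 3 - 6 * N + 3 * P) * Φ 1 0 +
        T * Φ 0 3 + (3 * N ^ 2 - 3 * P - 3 * T) * Φ 0 2 +
        (3 * N * r - 6 * N - 6 * N ^ 2 + 6 * P + 3 * T) * Φ 0 1 +
        (r ^ 2 - 3 * r + 2 - 3 * N * r + 6 * N + 3 * N ^ 2 - 3 * P - T) * Φ 0 0 := by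
  have hα0 : (α : K) ≠ 0 := α.ne_zero
  have hαN := generator_pow_ne_one hN hα
  have hβ0 : (α : K) ^ N ≠ 0 := pow_ne_zero N hα0
  have hg0 : (α : K) ^ d ≠ 0 := pow_ne_zero d hα0
  have hinj := codeword_injective hN hNM hd hgcd hα h3 hχ hψ hψχ hq hr hp hk hψp
  have himg : {c | c ∈ cyclicCode F q r h 3 α ∧ modifiedWeight q r h c = w} =
      (fun ab : K × K => codeword F q r h 3 α ab.1 ab.2) ''
        {v | modifiedWeight q r h (codeword F q r h 3 α v.1 v.2) = w} := by
    ext c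
    constructor
    · rintro ⟨⟨a, b, rfl⟩, hw⟩
      exact ⟨(a, b), hw, rfl⟩
    · rintro ⟨⟨a, b⟩, hw, rfl⟩
      exact ⟨⟨a, b, rfl⟩, hw⟩
  rw [himg, Set.ncard_image_of_injective _ hinj, Set.ncard_eq_toFinset_card', Set.toFinset_ofPred,
    card_filter, Nat.cast_sum]
  simp_rw [modifiedWeight_codeword_eq hN hNM hd hgcd hα h3 hχ hψ hψχ hq hr hp hk hψp]
  have hbij := Finite.injective_iff_bijective.1 (zeroSumCoords_injective hβ0 hαN)
  rw [hbij.sum_comp (fun v => ((if patternWeight q h N ((-p) ^ k) (zeroCount v)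
    (cubeCount N ((α : K) ^ d) v) = w then 1 else 0 : ℕ) : ℝ))]
  have hmain := sum_zeroSum_patterns (card_cubeCoset hN one_ne_zero hα0 hαN)
    (card_cubeCoset hN hg0 hα0 hαN) (card_cubeCoset hN (pow_ne_zero 2 hg0) hα0 hαN)
    (zero_notMem_cubeCoset hN) (zero_notMem_cubeCoset hN) (zero_notMem_cubeCoset hN)
    h01 h02 h12 (r := r) (by rw [hr]) hT
    (fun i j => if patternWeight q h N ((-p) ^ k) i j = w then 1 else 0)
  rw [← hmain]
  refine sum_congr rfl fun v _ => ?_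
  rw [Nat.cast_ite, Nat.cast_one, Nat.cast_zero]
  rfl

lemma hasModifiedWeightDistribution_table1 (h3d : 3 ∣ d) :
    HasModifiedWeightDistribution q r h (cyclicCode F q r h 3 α) (table1 q r h ((-p) ^ k)) := by
  classical
  intro w
  have hα0 : (α : K) ≠ 0 := α.ne_zero
  have hαN := generator_pow_ne_one hN hα
  have hg0 : (α : K) ^ d ≠ 0 := pow_ne_zero d hα0
  have hg := (generator_pow_pow_eq_one_iff hN hα d).2 h3d
  have hg2 : (((α : K) ^ d) ^ 2) ^ N = 1 := by rw [← pow_mul, mul_comm, pow_mul, hg, one_pow]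
  rw [ncard_modifiedWeight_eq hN hNM hd hgcd hα h3 hχ hψ hψχ hq hr hp hk hψp
    (card_cubeCoset_filter_neg_of_cube hN one_ne_zero (one_pow N) hg hα0 hαN)
    (card_cubeCoset_filter_neg_of_cube hN one_ne_zero (one_pow N) hg2 hα0 hαN)
    (card_cubeCoset_filter_neg_of_cube hN hg0 hg hg2 hα0 hαN)
    (card_zeroSumTriples_of_cube hN hψ hp hk hψp hα0 hαN hg0 hg).symm]
  have hNr : (N : ℝ) = (r - 1) / 3 := by rw [← hr, ← hN]; push_cast; ring
  rw [hr, hNr]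
  generalize (-(p : ℝ)) ^ k = S
  obtain ⟨δ, hδ⟩ : ∃ δ : ℝ → ℝ, ∀ (x f : ℝ) [Decidable (x = w)],
      (if x = w then f else 0) = f * δ x :=
    ⟨fun x => if x = w then 1 else 0, fun x f _ => by by_cases hx : x = w <;> simp [hx]⟩
  obtain ⟨w03, w00, w02, w01, w12, w10, w11, w30⟩ := patternWeight_values q h r S
  simp only [table1, List.map_cons, List.map_nil, List.sum_cons, List.sum_nil, hδ,
    w03, w00, w02, w01, w12, w10, w11, w30]
  ring

lemma hasModifiedWeightDistribution_table2 (h3d : ¬ 3 ∣ d) :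
    HasModifiedWeightDistribution q r h (cyclicCode F q r h 3 α) (table2 q r h ((-p) ^ k)) := by
  classical
  intro w
  have hα0 : (α : K) ≠ 0 := α.ne_zero
  have hαN := generator_pow_ne_one hN hα
  have hg0 : (α : K) ^ d ≠ 0 := pow_ne_zero d hα0
  have hg := (generator_pow_pow_eq_one_iff hN hα d).not.2 h3d
  have hg2 : (((α : K) ^ d) ^ 2) ^ N ≠ 1 := by
    rw [← pow_mul (α : K), ne_eq, generator_pow_pow_eq_one_iff hN hα]
    omega
  have hg12 : ((α : K) ^ d) ^ N ≠ (((α : K) ^ d) ^ 2) ^ N := by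
    rw [sq, mul_pow]
    intro hcon
    exact hg (mul_left_cancel₀ (pow_ne_zero N hg0) (hcon.symm.trans (mul_one _).symm))
  rw [ncard_modifiedWeight_eq hN hNM hd hgcd hα h3 hχ hψ hψχ hq hr hp hk hψp
    (card_cubeCoset_filter_neg_of_ne hN (by rw [one_pow]; exact Ne.symm hg))
    (card_cubeCoset_filter_neg_of_ne hN (by rw [one_pow]; exact hg2.symm))
    (card_cubeCoset_filter_neg_of_ne hN hg12)
    (card_zeroSumTriples_of_noncube hN hψ hp hk hψp hα0 hαN hg0 hg).symm]
  have hNr : (N : ℝ) = (r - 1) / 3 := by rw [← hr, ← hN]; push_cast; ring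
  rw [hr, hNr]
  generalize (-(p : ℝ)) ^ k = S
  obtain ⟨δ, hδ⟩ : ∃ δ : ℝ → ℝ, ∀ (x f : ℝ) [Decidable (x = w)],
      (if x = w then f else 0) = f * δ x :=
    ⟨fun x => if x = w then 1 else 0, fun x f _ => by by_cases hx : x = w <;> simp [hx]⟩
  obtain ⟨w03, w00, w02, w01, w12, w10, w11, w30⟩ := patternWeight_values q h r S
  simp only [table2, List.map_cons, List.map_nil, List.sum_cons, List.sum_nil, hδ,
    w03, w00, w02, w01, w12, w10, w11, w30]
  push_cast
  ring

end

/-- A power of a number congruent to `2` modulo `3` is congruent to `1` only for even exponents. -/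
lemma even_of_three_dvd_pow_sub_one {p s : ℕ} (hp : p % 3 = 2) (h : 3 ∣ p ^ s - 1) (hp0 : 0 < p) :
    Even s := by
  by_contra hs
  obtain ⟨t, rfl⟩ := Nat.not_even_iff_odd.1 hs
  have h1 : p ^ (2 * t + 1) ≡ 2 [MOD 3] := by
    have h2 : p ≡ 2 [MOD 3] := hp
    have h4 : p ^ 2 ≡ 1 [MOD 3] := h2.pow 2
    rw [pow_succ, pow_mul]
    simpa using (h4.pow t).mul h2
  have h2 : 0 < p ^ (2 * t + 1) := by positivity
  unfold Nat.ModEq at h1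
  omega


end CyclicCodeTwoZeros

theorem theorem1
    (p s q m r h : ℕ) (hp : p.Prime) (hp3 : p % 3 = 2)
    (hs : 0 < s) (hq : q = p ^ s) (hm : 0 < m) (hr : r = q ^ m)
    (hh : h ∣ q - 1) (he : 3 ∣ Nat.gcd (q - 1) (h * m))
    (hN : CyclicCodeTwoZeros.paramN q r h 3 = 3)
    {F K : Type*} [Field F] [Finite F] [Field K] [Finite K] [Algebra F K]
    (hF : Nat.card F = q) (hK : Nat.card K = r)
    (α : Kˣ) (hα : ∀ x : Kˣ, x ∈ Subgroup.zpowers α) :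
    (Function.Injective fun ab : K × K =>
      CyclicCodeTwoZeros.codeword F q r h 3 α ab.1 ab.2) ∧
    (3 ∣ (q - 1) / h →
      CyclicCodeTwoZeros.HasModifiedWeightDistribution q r h
        (CyclicCodeTwoZeros.cyclicCode F q r h 3 α)
        (CyclicCodeTwoZeros.table1 q r h ((-1 : ℝ) ^ (m * s / 2) * Real.sqrt r))) ∧
    (¬ 3 ∣ (q - 1) / h →
      CyclicCodeTwoZeros.HasModifiedWeightDistribution q r h
        (CyclicCodeTwoZeros.cyclicCode F q r h 3 α)
        (CyclicCodeTwoZeros.table2 q r h ((-1 : ℝ) ^ (m * s / 2) * Real.sqrt r))) := by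
  classical
  have := Fintype.ofFinite F
  have := Fintype.ofFinite K
  have : Fact p.Prime := ⟨hp⟩
  have hFc : Fintype.card F = q := by rw [← hF, Nat.card_eq_fintype_card]
  have hKc : Fintype.card K = r := by rw [← hK, Nat.card_eq_fintype_card]
  have hq1 : 1 < q := hFc ▸ Fintype.one_lt_card
  have hr1 : 1 < r := hKc ▸ Fintype.one_lt_card
  have hcF : CharP F p := charP_of_card_eq_prime_pow (f := s) (by rw [hFc, hq])
  have hcK : CharP K p := charP_of_injective_algebraMap (algebraMap F K).injective p
  obtain ⟨d, hd⟩ := hh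
  have hh0 : 0 < h := Nat.pos_of_ne_zero (by rintro rfl; omega)
  have hdiv : (q - 1) / h = d := Nat.div_eq_of_eq_mul_right hh0 hd
  have h3q : 3 ∣ q - 1 := he.trans (Nat.gcd_dvd_left _ _)
  obtain ⟨L, hL⟩ : q - 1 ∣ r - 1 := by
    rw [hr]; simpa using Nat.sub_dvd_pow_sub_pow q 1 m
  have hL' : (r - 1) / (q - 1) = L := Nat.div_eq_of_eq_mul_right (by omega) hL
  have hd' : 3 * (q - 1) / h = 3 * d :=
    Nat.div_eq_of_eq_mul_right hh0 (by rw [hd]; ring)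
  rw [CyclicCodeTwoZeros.paramN, hL', hd'] at hN
  obtain ⟨M, rfl⟩ : 3 ∣ L := hN ▸ Nat.gcd_dvd_left L (3 * d)
  have hcard : 3 * ((q - 1) * M) + 1 = Fintype.card K := by
    rw [hKc, mul_left_comm, ← hL]; omega
  have hs2 : Even s :=
    CyclicCodeTwoZeros.even_of_three_dvd_pow_sub_one hp3 (hq ▸ h3q) hp.pos
  have hk : 2 * (m * s / 2) = m * s := Nat.mul_div_cancel' (hs2.two_dvd.mul_left m)
  have hrp : r = p ^ (2 * (m * s / 2)) := by rw [hk, hr, hq, ← pow_mul, mul_comm]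
  have hS : (-1 : ℝ) ^ (m * s / 2) * Real.sqrt r = (-p) ^ (m * s / 2) := by
    have : (r : ℝ) = ((p : ℝ) ^ (m * s / 2)) ^ 2 := by
      rw [← pow_mul, mul_comm _ 2]; exact_mod_cast hrp
    rw [this, Real.sqrt_sq (by positivity), ← mul_pow, neg_one_mul]
  obtain ⟨χ, ψ, hχ, hψ, hψχ, hψp⟩ := CyclicCodeTwoZeros.exists_addChar F K p
  have hNM : (q - 1) * M = (Fintype.card F - 1) * M := by rw [hFc]
  have hdF : h * d = Fintype.card F - 1 := by rw [hFc, hd]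
  rw [hS, hdiv]
  exact ⟨CyclicCodeTwoZeros.codeword_injective hcard hNM hdF hN hα (h3q.mul_right M) hχ hψ hψχ hFc
      hKc hp3 (hKc.trans hrp) hψp,
    CyclicCodeTwoZeros.hasModifiedWeightDistribution_table1 hcard hNM hdF hN hα (h3q.mul_right M)
      hχ hψ hψχ hFc hKc hp3 (hKc.trans hrp) hψp,
    CyclicCodeTwoZeros.hasModifiedWeightDistribution_table2 hcard hNM hdF hN hα (h3q.mul_right M)
      hχ hψ hψχ hFc hKc hp3 (hKc.trans hrp) hψp⟩
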